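/- All manifolds are smooth, finite-dimensional, without boundary, Hausdorff and second countable. For a manifold $\mathcal M$ let $A_{\mathcal M}=C^\infty(\mathcal M)$, let $\mathfrak X^1(\mathcal M)$ be the $A_{\mathcal M}$-module of smooth vector fields, anchored by its action on functions, and let $\mathcal R(\mathfrak X^1(\mathcal M))$ be the free Lie–Rinehart algebra over $A_{\mathcal M}$ generated by this anchored module; denote its bracket by $[\![-,-]\!]$, and let $\mathcal R(\mathfrak X^1(\mathcal M))_{\le d}$ be the submodule generated by iterated brackets of at most $d$ vector fields. The bundle of infinitesimal paths $\mathcal{RT}\mathcal M\to\mathcal M$ is the (filtered) vector bundle having $\mathcal R(\mathfrak X^1(\mathcal M))$ as its module of smooth sections; its fibre at $p$ is $\mathcal R(\mathfrak X^1(\mathcal M))/\mathfrak m_p\mathcal R(\mathfrak X^1(\mathcal M))$, where $\mathfrak m_p\subset A_{\mathcal M}$ is the ideal of functions vanishing at $p$, and $T\mathcal M$ is its part of filtration $\le 1$. A smooth map $F:\mathcal M\to\mathcal N$ is a local embedding if every point of $\mathcal M$ has an open neighbourhood on which $F$ is an embedding (an immersion that is a homeomorphism onto its image). **Proposition (Embeddings).**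 One can assign to every local embedding $F:\mathcal M\to\mathcal N$ a smooth, filtration-preserving, fibrewise linear bundle map $\mathcal RF:\mathcal{RT}\mathcal M\to\mathcal{RT}\mathcal N$ covering $F$ such that: 1. $\mathcal RF$ extends $F$: on $T\mathcal M$ it is the differential $dF$, and it respects free brackets, i.e. if vector fields $X_1,\dots,X_k$ on $\mathcal M$ and $Y_1,\dots,Y_k$ on $\mathcal N$ satisfy $dF_q(X_i(q))=Y_i(F(q))$ for all $i$ and all $q$ in a neighbourhood of $p\in\mathcal M$, then for every Lie polynomial $w$ in $k$ variables over $\mathbb R$ one has $\mathcal RF\big(w(X_1,\dots,X_k)(p)\big)=w(Y_1,\dots,Y_k)(F(p))$, where $w$ is evaluated with $[\![-,-]\!]$; 2. the assignment is functorial: $\mathcal R(\mathrm{id}_{\mathcal M})=\mathrm{id}_{\mathcal{RT}\mathcal M}$, and $\mathcal R(G\circ F)=\mathcal RG\circ\mathcal RF$ for local embeddings $F:\mathcal M\to\mathcal N$, $G:\mathcal N\to\mathcal N'$. -/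

import Mathlib

open Set Filter Topology Manifold
open scoped ContDiff

universe u

/-! ### Free Lie–Rinehart algebras -/

section FreeLieRinehart

variable {k A V : Type*} [CommRing k] [CommRing A] [Algebra k A] [AddCommGroup V] [Module A V]

/-- Formal expressions built from elements of `V` by addition, multiplication by elements of `A`
and a binary bracket. -/
inductive LRTerm (A V : Type*) : Type _
  | of (m : V) : LRTerm A V
  | zero : LRTerm A V
  | add (x y : LRTerm A V) : LRTerm A V
  | smul (a : A) (x : LRTerm A V) : LRTerm A V
  | lie (x y : LRTerm A V) : LRTerm A V

/-- The action of a formal expression on `A`, generated by the anchor `ρ` of `V`. -/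
noncomputable def LRTerm.anchor (ρ : V →ₗ[A] Derivation k A A) : LRTerm A V → Derivation k A A
  | .of m => ρ m
  | .zero => 0
  | .add x y => x.anchor ρ + y.anchor ρ
  | .smul a x => a • x.anchor ρ
  | .lie x y => ⁅x.anchor ρ, y.anchor ρ⁆

/-- The smallest congruence on formal expressions for which the quotient is a Lie–Rinehart algebra
over `A` with anchor generated by `ρ`, and for which `V → quotient` is `A`-linear. -/
inductive LRTerm.Rel (ρ : V →ₗ[A] Derivation k A A) : LRTerm A V → LRTerm A V → Prop
  | refl (x) : Rel ρ x x
  | symm {x y} : Rel ρ x y → Rel ρ y x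
  | trans {x y z} : Rel ρ x y → Rel ρ y z → Rel ρ x z
  | add_congr {x x' y y'} : Rel ρ x x' → Rel ρ y y' → Rel ρ (.add x y) (.add x' y')
  | smul_congr (a) {x x'} : Rel ρ x x' → Rel ρ (.smul a x) (.smul a x')
  | lie_congr {x x' y y'} : Rel ρ x x' → Rel ρ y y' → Rel ρ (.lie x y) (.lie x' y')
  | add_assoc (x y z) : Rel ρ (.add (.add x y) z) (.add x (.add y z))
  | add_comm (x y) : Rel ρ (.add x y) (.add y x)
  | zero_add (x) : Rel ρ (.add .zero x) x
  | one_smul (x) : Rel ρ (.smul 1 x) x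
  | mul_smul (a b x) : Rel ρ (.smul (a * b) x) (.smul a (.smul b x))
  | smul_add (a x y) : Rel ρ (.smul a (.add x y)) (.add (.smul a x) (.smul a y))
  | add_smul (a b x) : Rel ρ (.smul (a + b) x) (.add (.smul a x) (.smul b x))
  | zero_smul (x) : Rel ρ (.smul 0 x) .zero
  | of_add (m n) : Rel ρ (.of (m + n)) (.add (.of m) (.of n))
  | of_smul (a m) : Rel ρ (.of (a • m)) (.smul a (.of m))
  | add_lie (x y z) : Rel ρ (.lie (.add x y) z) (.add (.lie x z) (.lie y z))
  | lie_add (x y z) : Rel ρ (.lie x (.add y z)) (.add (.lie x y) (.lie x z))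
  | lie_self (x) : Rel ρ (.lie x x) .zero
  | jacobi (x y z) : Rel ρ (.lie x (.lie y z)) (.add (.lie (.lie x y) z) (.lie y (.lie x z)))
  | leibniz (a x y) :
      Rel ρ (.lie x (.smul a y)) (.add (.smul a (.lie x y)) (.smul (x.anchor ρ a) y))

/-- The setoid of the congruence `LRTerm.Rel`. -/
def LRTerm.setoid (ρ : V →ₗ[A] Derivation k A A) : Setoid (LRTerm A V) :=
  ⟨LRTerm.Rel ρ, ⟨.refl, .symm, .trans⟩⟩

/-- The free Lie–Rinehart algebra over `A` generated by the `A`-module `V` with anchor `ρ`. -/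
def FreeLR (ρ : V →ₗ[A] Derivation k A A) : Type _ := Quotient (LRTerm.setoid ρ)

namespace FreeLR

variable (ρ : V →ₗ[A] Derivation k A A)

/-- The class of a formal expression. -/
def mk (t : LRTerm A V) : FreeLR ρ := Quotient.mk _ t


noncomputable instance : Add (FreeLR ρ) :=
  ⟨Quotient.map₂ .add fun _ _ h _ _ h' => LRTerm.Rel.add_congr h h'⟩

noncomputable instance : Zero (FreeLR ρ) := ⟨Quotient.mk _ .zero⟩

noncomputable instance : SMul A (FreeLR ρ) :=
  ⟨fun a => Quotient.map (.smul a) fun _ _ h => LRTerm.Rel.smul_congr a h⟩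

noncomputable instance : Neg (FreeLR ρ) := ⟨fun x => (-1 : A) • x⟩

noncomputable instance : Bracket (FreeLR ρ) (FreeLR ρ) :=
  ⟨Quotient.map₂ .lie fun _ _ h _ _ h' => LRTerm.Rel.lie_congr h h'⟩

protected theorem add_zero' (x : FreeLR ρ) : x + 0 = x := by
  induction x using Quotient.ind
  exact Quotient.sound (LRTerm.Rel.trans (.add_comm _ _) (.zero_add _))

protected theorem zero_smul' (x : FreeLR ρ) : (0 : A) • x = 0 := by
  induction x using Quotient.ind
  exact Quotient.sound (.zero_smul _)

protected theorem mul_smul' (a b : A) (x : FreeLR ρ) : (a * b) • x = a • b • x := by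
  induction x using Quotient.ind
  exact Quotient.sound (.mul_smul _ _ _)

noncomputable instance : AddCommMonoid (FreeLR ρ) where
  add_assoc x y z := by
    induction x using Quotient.ind; induction y using Quotient.ind; induction z using Quotient.ind
    exact Quotient.sound (.add_assoc _ _ _)
  zero_add x := by
    induction x using Quotient.ind
    exact Quotient.sound (.zero_add _)
  add_zero := FreeLR.add_zero' ρ
  add_comm x y := by
    induction x using Quotient.ind; induction y using Quotient.ind
    exact Quotient.sound (.add_comm _ _)
  nsmul := nsmulRec

noncomputable instance : Module A (FreeLR ρ) where
  one_smul x := by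
    induction x using Quotient.ind
    exact Quotient.sound (.one_smul _)
  mul_smul := FreeLR.mul_smul' ρ
  smul_zero a := by
    rw [← FreeLR.zero_smul' ρ 0, ← FreeLR.mul_smul', mul_zero]
  smul_add a x y := by
    induction x using Quotient.ind; induction y using Quotient.ind
    exact Quotient.sound (.smul_add _ _ _)
  add_smul a b x := by
    induction x using Quotient.ind
    exact Quotient.sound (.add_smul _ _ _)
  zero_smul := FreeLR.zero_smul' ρ

noncomputable instance : AddCommGroup (FreeLR ρ) where
  neg_add_cancel x := by
    change (-1 : A) • x + x = 0
    nth_rewrite 2 [← one_smul A x]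
    rw [← add_smul]
    simp
  zsmul := zsmulRec

noncomputable instance : LieRing (FreeLR ρ) where
  add_lie x y z := by
    induction x using Quotient.ind; induction y using Quotient.ind; induction z using Quotient.ind
    exact Quotient.sound (.add_lie _ _ _)
  lie_add x y z := by
    induction x using Quotient.ind; induction y using Quotient.ind; induction z using Quotient.ind
    exact Quotient.sound (.lie_add _ _ _)
  lie_self x := by
    induction x using Quotient.ind
    exact Quotient.sound (.lie_self _)
  leibniz_lie x y z := by
    induction x using Quotient.ind; induction y using Quotient.ind; induction z using Quotient.ind
    exact Quotient.sound (.jacobi _ _ _)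

/-- The generators. -/
noncomputable def of : V →ₗ[A] FreeLR ρ where
  toFun m := Quotient.mk _ (.of m)
  map_add' _ _ := Quotient.sound (.of_add _ _)
  map_smul' _ _ := Quotient.sound (.of_smul _ _)

theorem anchor_congr {x y : LRTerm A V} (h : LRTerm.Rel ρ x y) : x.anchor ρ = y.anchor ρ := by
  induction h with
  | refl => rfl
  | symm _ h => exact h.symm
  | trans _ _ h h' => exact h.trans h'
  | add_congr _ _ h h' => simp only [LRTerm.anchor, h, h']
  | smul_congr a _ h => simp only [LRTerm.anchor, h]
  | lie_congr _ _ h h' => simp only [LRTerm.anchor, h, h']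
  | add_assoc => simp only [LRTerm.anchor, add_assoc]
  | add_comm x y => simp only [LRTerm.anchor, add_comm (x.anchor ρ)]
  | zero_add => simp only [LRTerm.anchor, zero_add]
  | one_smul => simp only [LRTerm.anchor, one_smul]
  | mul_smul => simp only [LRTerm.anchor, mul_smul]
  | smul_add => simp only [LRTerm.anchor, smul_add]
  | add_smul => simp only [LRTerm.anchor, add_smul]
  | zero_smul => simp only [LRTerm.anchor, zero_smul]
  | of_add => simp only [LRTerm.anchor, map_add]
  | of_smul => simp only [LRTerm.anchor, map_smul]
  | add_lie => simp only [LRTerm.anchor, add_lie]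
  | lie_add => simp only [LRTerm.anchor, lie_add]
  | lie_self => simp only [LRTerm.anchor, lie_self]
  | jacobi x y z => simp only [LRTerm.anchor]; exact leibniz_lie _ _ _
  | leibniz a x y => simp only [LRTerm.anchor]; exact LieRinehartRing.leibniz_smul_right _ _ _

/-- The anchor of the free Lie–Rinehart algebra. -/
noncomputable def anchor : FreeLR ρ →ₗ[A] Derivation k A A where
  toFun := Quotient.lift (LRTerm.anchor ρ) fun _ _ h => anchor_congr ρ h
  map_add' x y := by
    induction x using Quotient.ind; induction y using Quotient.ind
    rfl
  map_smul' a x := by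
    induction x using Quotient.ind
    rfl

theorem anchor_lie (x y : FreeLR ρ) : anchor ρ ⁅x, y⁆ = ⁅anchor ρ x, anchor ρ y⁆ := by
  induction x using Quotient.ind; induction y using Quotient.ind
  rfl

theorem lie_smul' (x : FreeLR ρ) (a : A) (y : FreeLR ρ) :
    ⁅x, a • y⁆ = a • ⁅x, y⁆ + anchor ρ x a • y := by
  induction x using Quotient.ind; induction y using Quotient.ind
  exact Quotient.sound (.leibniz _ _ _)

noncomputable instance : Module k (FreeLR ρ) := Module.compHom _ (algebraMap k A)

instance : IsScalarTower k A (FreeLR ρ) where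
  smul_assoc c a x := by
    change (c • a) • x = (algebraMap k A c) • a • x
    rw [← mul_smul, Algebra.smul_def]

noncomputable instance : LieAlgebra k (FreeLR ρ) where
  lie_smul c x y := by
    change ⁅x, (algebraMap k A c) • y⁆ = (algebraMap k A c) • ⁅x, y⁆
    rw [lie_smul']
    simp

noncomputable instance : LieRingModule (FreeLR ρ) A where
  bracket x a := anchor ρ x a
  add_lie x y a := by change anchor ρ (x + y) a = _; simp
  lie_add x a b := map_add (anchor ρ x) a b
  leibniz_lie x y a := by
    change anchor ρ x (anchor ρ y a) = anchor ρ ⁅x, y⁆ a + anchor ρ y (anchor ρ x a)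
    simp [anchor_lie, Derivation.commutator_apply]

theorem lie_eq_anchor (x : FreeLR ρ) (a : A) : ⁅x, a⁆ = anchor ρ x a := rfl

instance : LieRinehartRing A (FreeLR ρ) where
  lie_smul_eq_mul' a b x := by simp [lie_eq_anchor]
  leibniz_mul_right' x a b := by simp [lie_eq_anchor, mul_comm b]
  leibniz_smul_right' x y a := lie_smul' ρ x a y

instance : LieModule k (FreeLR ρ) A where
  smul_lie c x a := by
    change anchor ρ ((algebraMap k A c) • x) a = c • anchor ρ x a
    simp [Algebra.smul_def]
  lie_smul c x a := by simp [lie_eq_anchor]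

instance : LieRinehartAlgebra k A (FreeLR ρ) where

/-- The universal property: an `A`-linear map from `V` to a Lie–Rinehart algebra over `A` that is
compatible with the anchors extends uniquely to a morphism of Lie–Rinehart algebras. -/
theorem existsUnique_lift {L : Type*} [LieRing L] [Module A L] [LieRingModule L A]
    [LieRinehartRing A L] [LieAlgebra k L] [LieRinehartAlgebra k A L] (f : V →ₗ[A] L)
    (hf : ∀ (m : V) (a : A), ⁅f m, a⁆ = ρ m a) :
    ∃! Φ : FreeLR ρ →ₗ[A] L, (∀ m, Φ (of ρ m) = f m) ∧ (∀ x y, Φ ⁅x, y⁆ = ⁅Φ x, Φ y⁆) ∧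
      ∀ (x : FreeLR ρ) (a : A), ⁅Φ x, a⁆ = anchor ρ x a := by
  let g : LRTerm A V → L := fun t => t.rec (fun m => f m) 0 (fun _ _ x y => x + y)
    (fun a _ x => a • x) (fun _ _ x y => ⁅x, y⁆)
  have hg : ∀ (t : LRTerm A V) (a : A), ⁅g t, a⁆ = t.anchor ρ a := by
    intro t
    induction t with
    | of m => exact hf m
    | zero => intro a; exact zero_lie a
    | add x y hx hy => intro a; exact (add_lie _ _ _).trans (by rw [hx, hy]; rfl)
    | smul b x hx => intro a; exact (LieRinehartRing.lie_smul_eq_mul _ _ _).trans (by rw [hx]; rfl)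
    | lie x y hx hy =>
      intro a
      exact (lie_lie _ _ _).trans (by rw [hx, hy, hx, hy]; exact (Derivation.commutator_apply ..).symm)
  have hr : ∀ x y, LRTerm.Rel ρ x y → g x = g y := by
    intro x y h
    induction h with
    | refl => rfl
    | symm _ h => exact h.symm
    | trans _ _ h h' => exact h.trans h'
    | add_congr _ _ h h' => exact congrArg₂ (· + ·) h h'
    | smul_congr a _ h => exact congrArg (a • ·) h
    | lie_congr _ _ h h' => exact congrArg₂ (⁅·, ·⁆) h h'
    | add_assoc => exact add_assoc _ _ _
    | add_comm x y => exact add_comm _ _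
    | zero_add => exact zero_add _
    | one_smul => exact one_smul _ _
    | mul_smul => exact mul_smul _ _ _
    | smul_add => exact smul_add _ _ _
    | add_smul => exact add_smul _ _ _
    | zero_smul => exact zero_smul _ _
    | of_add => exact map_add f _ _
    | of_smul => exact map_smul f _ _
    | add_lie => exact add_lie _ _ _
    | lie_add => exact lie_add _ _ _
    | lie_self => exact lie_self _
    | jacobi x y z => exact leibniz_lie _ _ _
    | leibniz a x y =>
      exact (LieRinehartRing.leibniz_smul_right _ _ _).trans (by rw [hg])
  refine ⟨{ toFun := Quotient.lift g hr, map_add' := ?_, map_smul' := ?_ }, ⟨?_, ?_, ?_⟩, ?_⟩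
  · intro x y; induction x using Quotient.ind; induction y using Quotient.ind; rfl
  · intro a x; induction x using Quotient.ind; rfl
  · intro m; rfl
  · intro x y; induction x using Quotient.ind; induction y using Quotient.ind; rfl
  · intro x; induction x using Quotient.ind; exact hg _
  · rintro Ψ ⟨h1, h2, -⟩
    ext x
    induction x using Quotient.ind with | _ t
    change Ψ (mk ρ t) = g t
    induction t with
    | of m => exact h1 m
    | zero => exact map_zero Ψ
    | add x y hx hy => exact (map_add Ψ (mk ρ x) (mk ρ y)).trans (by rw [hx, hy])
    | smul a x hx => exact (map_smul Ψ a (mk ρ x)).trans (by rw [hx])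
    | lie x y hx hy => exact (h2 (mk ρ x) (mk ρ y)).trans (by rw [hx, hy])

/-- `IsMonomial d x`: `x` is an iterated bracket of `d` generators. -/
inductive IsMonomial : ℕ → FreeLR ρ → Prop
  | of (m : V) : IsMonomial 1 (of ρ m)
  | lie {i j : ℕ} {x y : FreeLR ρ} : IsMonomial i x → IsMonomial j y → IsMonomial (i + j) ⁅x, y⁆

/-- The filtration by bracket length: step `d` is the `A`-submodule generated by the iterated
brackets of at most `d` generators. -/
noncomputable def filtration (d : ℕ) : Submodule A (FreeLR ρ) :=
  Submodule.span A {x | ∃ i ≤ d, IsMonomial ρ i x}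

end FreeLR

end FreeLieRinehart

/-! ### Manifolds, functions and vector fields -/

/-- A smooth manifold: finite-dimensional, without boundary, Hausdorff and second countable. -/
structure Mfd : Type (u + 1) where
  dim : ℕ
  carrier : Type u
  [top : TopologicalSpace carrier]
  [charted : ChartedSpace (EuclideanSpace ℝ (Fin dim)) carrier]
  [smooth : IsManifold (𝓡 dim) ∞ carrier]
  [t2 : T2Space carrier]
  [secondCountable : SecondCountableTopology carrier]

namespace Mfd

instance : CoeSort Mfd.{u} (Type u) := ⟨Mfd.carrier⟩

attribute [instance] Mfd.top Mfd.charted Mfd.smooth Mfd.t2 Mfd.secondCountable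

variable (M : Mfd.{u})

/-- The algebra of smooth real functions on `M`. -/
abbrev Fun : Type u := C^∞⟮𝓡 M.dim, M; 𝓘(ℝ, ℝ), ℝ⟯

/-- Smooth vector fields on `M`. -/
abbrev VF : Type u :=
  ContMDiffSection (𝓡 M.dim) (EuclideanSpace ℝ (Fin M.dim)) ∞
    (fun p : M => TangentSpace (𝓡 M.dim) p)

noncomputable instance : SMul M.Fun M.VF :=
  ⟨fun f X => ⟨fun p => f p • X p, f.contMDiff.smul_section X.contMDiff⟩⟩

theorem smul_VF_apply (f : M.Fun) (X : M.VF) (p : M) : (f • X) p = f p • X p := rfl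

noncomputable instance : Module M.Fun M.VF where
  one_smul X := by ext p; simp [smul_VF_apply]
  mul_smul f g X := by ext p; simp [smul_VF_apply, mul_smul]
  smul_zero f := by ext p; simp [smul_VF_apply]
  smul_add f X Y := by ext p; simp [smul_VF_apply]
  add_smul f g X := by ext p; simp [smul_VF_apply, add_smul]
  zero_smul X := by ext p; simp [smul_VF_apply]

variable {M}

/-- The derivative `X f` of a smooth function along a vector field. -/
noncomputable def VF.deriv (X : M.VF) (f : M.Fun) : M.Fun :=
  ⟨fun p => mvfderiv (𝓡 M.dim) f p (X p), by
    exact (contMDiff_snd_tangentBundle_modelSpace ℝ 𝓘(ℝ, ℝ)).comp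
      ((f.contMDiff.contMDiff_tangentMap (m := ∞) (by simp)).comp X.contMDiff)⟩

variable (M)

/-- The anchor: vector fields acting on functions by derivations. -/
noncomputable def anchor : M.VF →ₗ[M.Fun] Derivation ℝ M.Fun M.Fun where
  toFun X := Derivation.mk'
    { toFun := X.deriv
      map_add' := fun f g => by
        ext p
        have h := mvfderiv_add (f.mdifferentiableAt (x := p)) (g.mdifferentiableAt (x := p))
        exact congrArg (fun L => L (X p)) h
      map_smul' := fun c f => by
        ext p
        have h := mvfderiv_smul (mdifferentiableAt_const (c := c)) (f.mdifferentiableAt (x := p))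
        rw [mvfderiv_const] at h
        refine (congrArg (fun L => L (X p)) h).trans ?_
        change c * mvfderiv (𝓡 M.dim) f p (X p) + _ = c * mvfderiv (𝓡 M.dim) f p (X p)
        simp }
    fun f g => by
      ext p
      have h := mvfderiv_mul (f.mdifferentiableAt (x := p)) (g.mdifferentiableAt (x := p))
      exact congrArg (fun L => L (X p)) h
  map_add' X Y := by
    ext f p
    exact map_add (mvfderiv (𝓡 M.dim) f p) (X p) (Y p)
  map_smul' f X := by
    ext g p
    exact map_smul (mvfderiv (𝓡 M.dim) g p) (f p) (X p)

theorem anchor_apply (X : M.VF) (f : M.Fun) (p : M) :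
    M.anchor X f p = mvfderiv (𝓡 M.dim) f p (X p) := rfl

/-! ### The bundle of infinitesimal paths -/

/-- The infinitesimal paths on `M`: the free Lie–Rinehart algebra over the algebra of smooth
functions, generated by the module of vector fields. -/
abbrev R : Type u := FreeLR M.anchor

/-- The infinitesimal paths on `M` that are generated by brackets of at most `d` vector fields. -/
noncomputable abbrev Rle (d : ℕ) : Submodule M.Fun M.R := FreeLR.filtration M.anchor d

variable {M} in
/-- The maximal ideal of the functions vanishing at `p`. -/
noncomputable def maxIdeal (p : M) : Ideal M.Fun where
  carrier := {f | f p = 0}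
  add_mem' {f g} hf hg := by
    change f p + g p = 0
    rw [show f p = 0 from hf, show g p = 0 from hg, add_zero]
  zero_mem' := rfl
  smul_mem' f g hg := by
    change f p * g p = 0
    rw [show g p = 0 from hg, mul_zero]

variable {M} in
/-- The fibre at `p` of the vector bundle whose module of sections is `M.R`: the quotient of `M.R`
by the multiples of functions vanishing at `p`. -/
abbrev RTFibre (p : M) : Type u := M.R ⧸ (maxIdeal p • ⊤ : Submodule M.Fun M.R)

variable {M} in
/-- The value at `p` of an infinitesimal path, regarded as a section of the bundle. -/
noncomputable def value (p : M) : M.R →ₗ[ℝ] RTFibre p :=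
  (Submodule.mkQ (maxIdeal p • ⊤ : Submodule M.Fun M.R)).restrictScalars ℝ

/-- The total space of the bundle of infinitesimal paths on `M`. -/
def RT : Type u := Σ p : M, RTFibre p

/-- The bundle projection. -/
def RT.proj (z : M.RT) : M := z.1

end Mfd

/-! ### Bundle maps and local embeddings -/

/-- A smooth section over `M` of the pull-back along `F : M → N` of the step-`d` subbundle of the
bundle of infinitesimal paths on `N`: a family of vectors that is locally a finite combination, with
smooth coefficients on `M`, of values along `F` of sections over `N` of filtration at most `d`. -/
def IsSmoothAlong {M N : Mfd.{u}} (F : M → N) (d : ℕ) (s : ∀ p : M, Mfd.RTFibre (F p)) : Prop :=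
  ∀ p : M, ∃ (n : ℕ) (f : Fin n → M.Fun) (v : Fin n → N.R), (∀ i, v i ∈ N.Rle d) ∧
    ∀ᶠ q in 𝓝 p, s q = ∑ i, f i q • Mfd.value (F q) (v i)

/-- A map of vector bundles from the bundle of infinitesimal paths on `M` to that on `N`, covering
`F : M → N`: it is linear on the fibres, and, in every step of the filtration, it is smooth, which
for a fibrewise linear map means that it takes smooth sections to smooth sections along `F`. -/
structure RTMap {M N : Mfd.{u}} (F : M → N) where
  fibre : ∀ p : M, Mfd.RTFibre p →ₗ[ℝ] Mfd.RTFibre (F p)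
  smooth : ∀ (d : ℕ), ∀ u ∈ M.Rle d, IsSmoothAlong F d fun p => fibre p (Mfd.value p u)

namespace RTMap

variable {M N : Mfd.{u}} {F : M → N}

/-- The map on total spaces. -/
noncomputable def total (Φ : RTMap F) : M.RT → N.RT := fun z => ⟨F z.1, Φ.fibre z.1 z.2⟩

theorem proj_total (Φ : RTMap F) (z : M.RT) : (Φ.total z).proj = F z.proj := rfl

/-- `Φ` extends `F` to infinitesimal paths.

* On the generators, i.e. on tangent vectors, it is the differential of `F`.
* It takes brackets to brackets: if the vector fields `Y i` on `N` are `F`-related near `p` to the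
  vector fields `X i` on `M`, then any Lie polynomial in the `X i`, formed with the free bracket, is
  taken at `p` to the same Lie polynomial in the `Y i` at `F p`. -/
structure Extends (Φ : RTMap F) : Prop where
  differential : ∀ (p : M) (X : M.VF) (Y : N.VF),
    mfderiv (𝓡 M.dim) (𝓡 N.dim) F p (X p) = Y (F p) →
    Φ.fibre p (Mfd.value p (FreeLR.of M.anchor X)) = Mfd.value (F p) (FreeLR.of N.anchor Y)
  bracket : ∀ (p : M) (k : ℕ) (X : Fin k → M.VF) (Y : Fin k → N.VF),
    (∀ i, ∀ᶠ q in 𝓝 p, mfderiv (𝓡 M.dim) (𝓡 N.dim) F q (X i q) = Y i (F q)) →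
    ∀ w : FreeLieAlgebra ℝ (Fin k),
      Φ.fibre p (Mfd.value p (FreeLieAlgebra.lift ℝ (fun i => FreeLR.of M.anchor (X i)) w)) =
        Mfd.value (F p) (FreeLieAlgebra.lift ℝ (fun i => FreeLR.of N.anchor (Y i)) w)

end RTMap

/-- A smooth map that is locally on the source an embedding: every point of the source has an open
neighbourhood on which the map is an immersion and a homeomorphism onto its image. -/
structure LocalEmbedding (M N : Mfd.{u}) where
  toFun : M → N
  smooth : ContMDiff (𝓡 M.dim) (𝓡 N.dim) ∞ toFun
  locally_embedding : ∀ p : M, ∃ U : Set M, IsOpen U ∧ p ∈ U ∧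
    (∀ q ∈ U, IsImmersionAt (𝓡 M.dim) (𝓡 N.dim) ∞ toFun q) ∧ IsEmbedding (U.domRestrict toFun)

namespace LocalEmbedding

instance (M N : Mfd.{u}) : CoeFun (LocalEmbedding M N) (fun _ => M → N) := ⟨toFun⟩

/-- The identity map. -/
def id (M : Mfd.{u}) : LocalEmbedding M M where
  toFun p := p
  smooth := contMDiff_id
  locally_embedding _ := ⟨univ, isOpen_univ, mem_univ _,
    fun q _ => IsImmersion.id.isImmersionAt q, IsEmbedding.subtypeVal⟩

theorem isImmersionAt_comp {a b c : ℕ} {M N P : Type*}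
    [TopologicalSpace M] [ChartedSpace (EuclideanSpace ℝ (Fin a)) M]
    [TopologicalSpace N] [ChartedSpace (EuclideanSpace ℝ (Fin b)) N] [IsManifold (𝓡 b) ∞ N]
    [TopologicalSpace P] [ChartedSpace (EuclideanSpace ℝ (Fin c)) P]
    {f : M → N} {g : N → P} {x : M} (hg : IsImmersionAt (𝓡 b) (𝓡 c) ∞ g (f x))
    (hf : IsImmersionAt (𝓡 a) (𝓡 b) ∞ f x) : IsImmersionAt (𝓡 a) (𝓡 c) ∞ (g ∘ f) x := by
  obtain ⟨F, _, _, hf⟩ := hf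
  obtain ⟨F', _, _, hg⟩ := hg
  have hfc := hf.continuousAt
  have hgc := hg.continuousAt
  obtain ⟨s, hs, hso, hxs⟩ := mem_nhds_iff.mp
    (hfc.preimage_mem_nhds (hg.domChart.open_source.mem_nhds hg.mem_domChart_source))
  let τ := hg.domChart.symm ≫ₕ hf.codChart
  have hτ : τ ∈ contDiffGroupoid ∞ (𝓡 b) :=
    StructureGroupoid.compatible_of_mem_maximalAtlas hg.domChart_mem_maximalAtlas
      hf.codChart_mem_maximalAtlas
  rw [contDiffGroupoid, mem_groupoid_of_pregroupoid] at hτ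
  have h1 : ContDiffOn ℝ ∞ τ τ.source := by simpa [contDiffPregroupoid] using hτ.1
  have h2 : ContDiffOn ℝ ∞ τ.symm τ.target := by simpa [contDiffPregroupoid] using hτ.2
  let L := hg.equiv
  let σ : OpenPartialHomeomorph (EuclideanSpace ℝ (Fin c)) (EuclideanSpace ℝ (Fin c)) :=
    L.symm.toHomeomorph.toOpenPartialHomeomorph ≫ₕ
      (τ.prod (OpenPartialHomeomorph.refl F')) ≫ₕ L.toHomeomorph.toOpenPartialHomeomorph
  have hσ : σ ∈ contDiffGroupoid ∞ (𝓡 c) := by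
    rw [contDiffGroupoid, mem_groupoid_of_pregroupoid]
    constructor
    · suffices ContDiffOn ℝ ∞ σ σ.source by simpa [contDiffPregroupoid] using this
      have : ContDiffOn ℝ ∞ (fun z => L (τ (L.symm z).1, (L.symm z).2)) σ.source := by
        refine L.contDiff.comp_contDiffOn ((h1.comp (by fun_prop) ?_).prodMk (by fun_prop))
        intro z hz
        simpa [σ] using hz
      exact this
    · suffices ContDiffOn ℝ ∞ σ.symm σ.target by simpa [contDiffPregroupoid] using this
      have : ContDiffOn ℝ ∞ (fun z => L (τ.symm (L.symm z).1, (L.symm z).2)) σ.target := by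
        refine L.contDiff.comp_contDiffOn ((h2.comp (by fun_prop) ?_).prodMk (by fun_prop))
        intro z hz
        simpa [σ] using hz
      exact this
  have hθ : hg.codChart ≫ₕ σ ∈ IsManifold.maximalAtlas (𝓡 c) ∞ P := by
    have hm := hg.codChart_mem_maximalAtlas
    rw [IsManifold.maximalAtlas, mem_maximalAtlas_iff] at hm ⊢
    intro e he
    constructor
    · rw [OpenPartialHomeomorph.trans_symm_eq_symm_trans_symm, OpenPartialHomeomorph.trans_assoc]
      exact StructureGroupoid.trans _ (StructureGroupoid.symm _ hσ) (hm e he).1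
    · rw [← OpenPartialHomeomorph.trans_assoc]
      exact StructureGroupoid.trans _ (hm e he).2 hσ
  have key : ∀ y ∈ hf.domChart.source, f y ∈ hg.domChart.source →
      hg.codChart (g (f y)) = L (hg.domChart (f y), 0) := by
    intro y hy hy'
    have := hg.writtenInCharts (show hg.domChart (f y) ∈ (hg.domChart.extend (𝓡 b)).target by
      simpa using hg.domChart.map_source hy')
    simpa [hg.domChart.left_inv hy'] using this
  have key2 : ∀ y ∈ hf.domChart.source, hf.codChart (f y) = hf.equiv (hf.domChart y, 0) := by
    intro y hy
    have := hf.writtenInCharts (show hf.domChart y ∈ (hf.domChart.extend (𝓡 a)).target by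
      simpa using hf.domChart.map_source hy)
    simpa [hf.domChart.left_inv hy] using this
  have hfx : f x ∈ hg.domChart.source := hs hxs
  refine (IsImmersionAtOfComplement.mk_of_continuousAt (F := F × F') (hgc.comp hfc)
    ((ContinuousLinearEquiv.prodAssoc ℝ _ F F').symm.trans
      ((hf.equiv.prodCongr (ContinuousLinearEquiv.refl ℝ F')).trans L))
    (hf.domChart.restr s) (hg.codChart ≫ₕ σ) ?_ ?_ ?_ hθ ?_).isImmersionAt
  · simp [hso.interior_eq, hxs, hf.mem_domChart_source]
  · have := hf.mem_codChart_source
    simp [σ, τ, hg.mem_codChart_source, key x hf.mem_domChart_source hfx,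
      hg.domChart.left_inv hfx, hg.domChart.map_source hfx, this]
  · exact restr_mem_maximalAtlas _ hf.domChart_mem_maximalAtlas hso
  · intro u hu
    have hu' : u ∈ hf.domChart.target ∧ hf.domChart.symm u ∈ s := by
      simpa [hso.interior_eq] using hu
    have hy := hf.domChart.map_target hu'.1
    have hfy : f (hf.domChart.symm u) ∈ hg.domChart.source := hs hu'.2
    simp [σ, τ, key _ hy hfy, hg.domChart.left_inv hfy, key2 _ hy, hf.domChart.right_inv hu'.1]
    exact ⟨rfl, rfl⟩

/-- The composition of local embeddings. -/
def comp {M N P : Mfd.{u}} (G : LocalEmbedding N P) (F : LocalEmbedding M N) :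
    LocalEmbedding M P where
  toFun p := G (F p)
  smooth := G.smooth.comp F.smooth
  locally_embedding p := by
    obtain ⟨U, hU, hpU, hUi, hUe⟩ := F.locally_embedding p
    obtain ⟨V, hV, hpV, hVi, hVe⟩ := G.locally_embedding (F p)
    refine ⟨U ∩ F ⁻¹' V, hU.inter (hV.preimage F.smooth.continuous), ⟨hpU, hpV⟩,
      fun q hq => isImmersionAt_comp (hVi _ hq.2) (hUi q hq.1), ?_⟩
    have h1 : IsEmbedding (fun q : (U ∩ F ⁻¹' V : Set M) => F q) :=
      hUe.comp (IsEmbedding.inclusion inter_subset_left)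
    exact hVe.comp (h1.codRestrict V fun q => q.2.2)

end LocalEmbedding

/-!
A local embedding `F : M → N` does not push vector fields forward, but near a point `p` of `M` every
vector field `X` on `M` is `F`-related to some vector field `Y` on `N`, and every function on `M` is
the restriction along `F` of a function on `N`. Forming in parallel the same sums, multiples and
free brackets of `F`-related data produces the pairs of `F`-related infinitesimal paths
(`FreeLR.Related`, `Mfd.PathRelated`), and the bundle map takes the value at `p` of an infinitesimal
path to the value at `F p` of any path that is `F`-related to it (`Mfd.fibreMap`).

The point is that this is well defined. Let `I` be the ideal of functions on `N` whose restriction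
along `F` vanishes near `p`. Two vector fields related to the same `X` differ by an element of
`I • VF N` (`Mfd.mem_ideal_smul_top`). The anchor of a path on `N` that is related to one on `M`
preserves `I`, so by the Leibniz rule `I • R N` absorbs brackets with such paths
(`FreeLR.lie_sub_lie_mem`). Hence all relations that define the free Lie–Rinehart algebra of `M`
hold modulo `I • R N` after translation to `N`, and a path on `M` has a unique counterpart modulo
`I • R N` (`FreeLR.Related.sub_mem`). As `I` lies in the maximal ideal at `F p`, the value at `F p`
is determined. This part is pure algebra and is carried out for two anchored modules over rings that
are compared through a third ring, here the ring of germs at `p`.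

The geometric input is that functions extend locally through an immersion
(`Mfd.exists_fun_extension`) and that vector fields have coefficients in local coordinates
(`Mfd.exists_localCoordinates`). Compatibility with brackets is built into the construction.
Smoothness holds because an iterated bracket of vector fields has one counterpart that serves for
all points near `p`, and functoriality because every path on `M` has a counterpart compatible with
both maps.
-/

/-! ### Related elements of two free Lie–Rinehart algebras -/

section Correspondence

variable {k A B C V W : Type*} [CommRing k] [CommRing A] [Algebra k A] [CommRing B] [Algebra k B]
  [CommRing C] [AddCommGroup V] [Module A V] [AddCommGroup W] [Module B W]

/-- A relation `r` between two anchored modules `V` and `W` over the rings `A` and `B`, where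
elements of `A` and `B` are compared by their images in a third ring `C`. It is compatible with the
module structures and with the anchors, every element of `A` or `V` has a counterpart, and the
counterpart of an element of `V` is unique up to the multiples of the kernel of `B → C`. -/
structure IsCorrespondence (ρ : V →ₗ[A] Derivation k A A) (σ : W →ₗ[B] Derivation k B B)
    (α : A →+* C) (β : B →+* C) (r : V → W → Prop) : Prop where
  add : ∀ {x x' y y'}, r x y → r x' y' → r (x + x') (y + y')
  smul : ∀ {a b x y}, α a = β b → r x y → r (a • x) (b • y)
  anchor : ∀ {x y a b}, r x y → α a = β b → α (ρ x a) = β (σ y b)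
  exists_coeff : ∀ a, ∃ b, α a = β b
  exists_related : ∀ x, ∃ y, r x y
  sub_mem : ∀ {x y y'}, r x y → r x y' → y - y' ∈ (RingHom.ker β • ⊤ : Submodule B W)

namespace FreeLR

variable (ρ : V →ₗ[A] Derivation k A A) (σ : W →ₗ[B] Derivation k B B)
  (α : A →+* C) (β : B →+* C) (r : V → W → Prop)

/-- The relation between two free Lie–Rinehart algebras generated by a relation `r` between the
generators: the smallest one that is closed under sums, under brackets, and under multiplication by
elements of `A` and `B` with the same image in `C`. -/
inductive Related : FreeLR ρ → FreeLR σ → Prop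
  | of {x y} : r x y → Related (of ρ x) (of σ y)
  | zero : Related 0 0
  | add {x x' y y'} : Related x y → Related x' y' → Related (x + x') (y + y')
  | smul {a b x y} : α a = β b → Related x y → Related (a • x) (b • y)
  | lie {x x' y y'} : Related x y → Related x' y' → Related ⁅x, x'⁆ ⁅y, y'⁆

variable {ρ σ α β r}

theorem lie_mem_smul_top {I : Ideal B} {x y : FreeLR σ} (hx : ∀ i ∈ I, FreeLR.anchor σ x i ∈ I)
    (hy : y ∈ (I • ⊤ : Submodule B (FreeLR σ))) : ⁅x, y⁆ ∈ (I • ⊤ : Submodule B (FreeLR σ)) := by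
  refine Submodule.smul_induction_on hy (fun i hi z _ => ?_) (fun y z hy hz => ?_)
  · rw [lie_smul']
    exact add_mem (Submodule.smul_mem_smul hi trivial) (Submodule.smul_mem_smul (hx i hi) trivial)
  · rw [lie_add]
    exact add_mem hy hz

/-- Among the elements whose anchor preserves an ideal `I`, the bracket respects congruence modulo
the multiples of `I`. The anchor condition is needed only for the two factors that remain fixed when
the bracket is changed one factor at a time. -/
theorem lie_sub_lie_mem {I : Ideal B} {x x' y y' : FreeLR σ}
    (hx : ∀ i ∈ I, FreeLR.anchor σ x i ∈ I) (hy' : ∀ i ∈ I, FreeLR.anchor σ y' i ∈ I)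
    (hxx : x - x' ∈ (I • ⊤ : Submodule B (FreeLR σ)))
    (hyy : y - y' ∈ (I • ⊤ : Submodule B (FreeLR σ))) :
    ⁅x, y⁆ - ⁅x', y'⁆ ∈ (I • ⊤ : Submodule B (FreeLR σ)) := by
  have h : ⁅x, y⁆ - ⁅x', y'⁆ = ⁅x, y - y'⁆ - ⁅y', x - x'⁆ := by
    rw [lie_sub, lie_sub, ← lie_skew x y', ← lie_skew x' y']
    abel
  rw [h]
  exact sub_mem (lie_mem_smul_top hx hyy) (lie_mem_smul_top hy' hxx)

theorem smul_sub_smul_mem {I : Ideal B} {b b' : B} {x x' : FreeLR σ} (hb : b - b' ∈ I)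
    (hx : x - x' ∈ (I • ⊤ : Submodule B (FreeLR σ))) :
    b • x - b' • x' ∈ (I • ⊤ : Submodule B (FreeLR σ)) := by
  have h : b • x - b' • x' = (b - b') • x + b' • (x - x') := by
    rw [sub_smul, smul_sub]; abel
  rw [h]
  exact add_mem (Submodule.smul_mem_smul hb trivial) (Submodule.smul_mem _ _ hx)

theorem of_mem_smul_top {I : Ideal B} {y : W} (hy : y ∈ (I • ⊤ : Submodule B W)) :
    of σ y ∈ (I • ⊤ : Submodule B (FreeLR σ)) := by
  refine Submodule.smul_induction_on hy (fun i hi z _ => ?_) (fun y z hy hz => ?_)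
  · rw [map_smul]
    exact Submodule.smul_mem_smul hi trivial
  · rw [map_add]
    exact add_mem hy hz

namespace Related

theorem anchor (h : IsCorrespondence ρ σ α β r) {u : FreeLR ρ} {v : FreeLR σ}
    (huv : Related ρ σ α β r u v) :
    ∀ {a b}, α a = β b → α (FreeLR.anchor ρ u a) = β (FreeLR.anchor σ v b) := by
  induction huv with
  | of hr => exact fun hab => h.anchor hr hab
  | zero => intros; simp
  | add _ _ h1 h2 => intro a b hab; simp [h1 hab, h2 hab]
  | smul hc _ h1 => intro a b hab; simp [h1 hab, hc]
  | lie _ _ h1 h2 =>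
    intro a b hab
    simp [anchor_lie, Derivation.commutator_apply, h1 (h2 hab), h2 (h1 hab)]

theorem anchor_mem_ker (h : IsCorrespondence ρ σ α β r) {u : FreeLR ρ} {v : FreeLR σ}
    (huv : Related ρ σ α β r u v) :
    ∀ i ∈ RingHom.ker β, FreeLR.anchor σ v i ∈ RingHom.ker β := by
  intro i hi
  have := huv.anchor h (a := 0) (b := i) (by rw [map_zero]; exact hi.symm)
  rw [map_zero, map_zero] at this
  exact this.symm

theorem exists_related (h : IsCorrespondence ρ σ α β r) (u : FreeLR ρ) :
    ∃ v, Related ρ σ α β r u v := by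
  induction u using Quotient.ind with | _ t
  change ∃ v, Related ρ σ α β r (mk ρ t) v
  induction t with
  | of x => obtain ⟨y, hy⟩ := h.exists_related x; exact ⟨_, .of hy⟩
  | zero => exact ⟨0, .zero⟩
  | add x y hx hy => obtain ⟨v, hv⟩ := hx; obtain ⟨w, hw⟩ := hy; exact ⟨_, hv.add hw⟩
  | smul a x hx =>
    obtain ⟨v, hv⟩ := hx; obtain ⟨b, hb⟩ := h.exists_coeff a; exact ⟨_, hv.smul hb⟩
  | lie x y hx hy => obtain ⟨v, hv⟩ := hx; obtain ⟨w, hw⟩ := hy; exact ⟨_, hv.lie hw⟩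

/-- An element of the free Lie–Rinehart algebra over `A` has at most one counterpart modulo the
multiples of the kernel of `B → C`. Formal expressions are translated by choosing a counterpart of
every coefficient and every generator; modulo the kernel the translation respects the defining
relations of the free Lie–Rinehart algebra, and every related pair arises from it. -/
theorem sub_mem (h : IsCorrespondence ρ σ α β r) {u : FreeLR ρ} {v v' : FreeLR σ}
    (hv : Related ρ σ α β r u v)
    (hv' : Related ρ σ α β r u v') : v - v' ∈ (RingHom.ker β • ⊤ : Submodule B (FreeLR σ)) := by
  choose c hc using h.exists_coeff
  choose e he using h.exists_related
  let g : LRTerm A V → FreeLR σ := fun t => t.rec (fun x => FreeLR.of σ (e x)) 0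
    (fun _ _ x y => x + y) (fun a _ x => c a • x) (fun _ _ x y => ⁅x, y⁆)
  have hg : ∀ t, Related ρ σ α β r (mk ρ t) (g t) := by
    intro t
    induction t with
    | of x => exact .of (he x)
    | zero => exact .zero
    | add x y hx hy => exact hx.add hy
    | smul a x hx => exact hx.smul (hc a)
    | lie x y hx hy => exact hx.lie hy
  have hk : ∀ {b b'}, β b = β b' → b - b' ∈ RingHom.ker β := fun hb => by
    rw [RingHom.mem_ker, map_sub, hb, sub_self]
  have hgT := fun t => (hg t).anchor_mem_ker h
  let K : Submodule B (FreeLR σ) := RingHom.ker β • ⊤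
  have hK : ∀ {x : FreeLR σ}, x - x ∈ K := fun {x} => by rw [sub_self]; exact zero_mem _
  have hKs : ∀ {b b'} {x : FreeLR σ}, β b = β b' → b • x - b' • x ∈ K :=
    fun hb => smul_sub_smul_mem (hk hb) hK
  have hof : ∀ {x y y'}, r x y → r x y' → FreeLR.of σ y - FreeLR.of σ y' ∈ K := fun h1 h2 => by
    rw [← map_sub]; exact of_mem_smul_top (h.sub_mem h1 h2)
  have hrel : ∀ t t', LRTerm.Rel ρ t t' → g t - g t' ∈ K := by
    intro t t' ht
    induction ht with
    | refl => exact hK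
    | symm _ h => rw [← neg_sub]; exact neg_mem h
    | trans _ _ h h' => rw [← sub_add_sub_cancel]; exact add_mem h h'
    | add_congr _ _ h h' =>
      exact (add_sub_add_comm _ _ _ _ : _ = (_ : FreeLR σ)) ▸ add_mem h h'
    | smul_congr a _ h => exact smul_sub_smul_mem (hk rfl) h
    | lie_congr _ _ h h' => exact lie_sub_lie_mem (hgT _) (hgT _) h h'
    | add_assoc x y z =>
      change g x + g y + g z - (g x + (g y + g z)) ∈ K
      rw [add_assoc]; exact hK
    | add_comm x y =>
      change g x + g y - (g y + g x) ∈ K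
      rw [add_comm]; exact hK
    | zero_add x =>
      change 0 + g x - g x ∈ K
      rw [zero_add]; exact hK
    | one_smul x =>
      change c 1 • g x - g x ∈ K
      nth_rewrite 2 [← one_smul B (g x)]
      exact hKs (by rw [← hc]; simp)
    | mul_smul a b x =>
      change c (a * b) • g x - c a • c b • g x ∈ K
      rw [← mul_smul]
      exact hKs (by simp [← hc])
    | smul_add a x y =>
      change c a • (g x + g y) - (c a • g x + c a • g y) ∈ K
      rw [smul_add]; exact hK
    | add_smul a b x =>
      change c (a + b) • g x - (c a • g x + c b • g x) ∈ K
      rw [← add_smul]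
      exact hKs (by simp [← hc])
    | zero_smul x =>
      change c 0 • g x - 0 ∈ K
      rw [← zero_smul B (g x)]
      exact hKs (by simp [← hc])
    | of_add m n =>
      change FreeLR.of σ (e (m + n)) - (FreeLR.of σ (e m) + FreeLR.of σ (e n)) ∈ K
      rw [← map_add]
      exact hof (he _) (h.add (he _) (he _))
    | of_smul a m =>
      change FreeLR.of σ (e (a • m)) - c a • FreeLR.of σ (e m) ∈ K
      rw [← map_smul]
      exact hof (he _) (h.smul (hc a) (he _))
    | add_lie x y z =>
      change ⁅g x + g y, g z⁆ - (⁅g x, g z⁆ + ⁅g y, g z⁆) ∈ K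
      rw [add_lie]; exact hK
    | lie_add x y z =>
      change ⁅g x, g y + g z⁆ - (⁅g x, g y⁆ + ⁅g x, g z⁆) ∈ K
      rw [lie_add]; exact hK
    | lie_self x =>
      change ⁅g x, g x⁆ - 0 ∈ K
      rw [lie_self]; exact hK
    | jacobi x y z =>
      change ⁅g x, ⁅g y, g z⁆⁆ - (⁅⁅g x, g y⁆, g z⁆ + ⁅g y, ⁅g x, g z⁆⁆) ∈ K
      rw [leibniz_lie]; exact hK
    | leibniz a x y =>
      change ⁅g x, c a • g y⁆ - (c a • ⁅g x, g y⁆ + c (x.anchor ρ a) • g y) ∈ K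
      rw [lie_smul', add_sub_add_left_eq_sub]
      refine hKs ?_
      rw [← hc, ← (hg x).anchor h (hc a)]
      rfl
  have key : ∀ {u v}, Related ρ σ α β r u v → ∃ t, mk ρ t = u ∧ v - g t ∈ K := by
    intro u v huv
    induction huv with
    | @of x y hr => exact ⟨.of x, rfl, hof hr (he x)⟩
    | zero => exact ⟨.zero, rfl, hK⟩
    | add _ _ h1 h2 =>
      obtain ⟨t, rfl, ht⟩ := h1
      obtain ⟨t', rfl, ht'⟩ := h2
      exact ⟨.add t t', rfl, (add_sub_add_comm _ _ _ _ : _ = (_ : FreeLR σ)) ▸ add_mem ht ht'⟩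
    | @smul a b _ _ hab _ h1 =>
      obtain ⟨t, rfl, ht⟩ := h1
      exact ⟨.smul a t, rfl, smul_sub_smul_mem (hk (by rw [← hab, hc])) ht⟩
    | lie hx _ h1 h2 =>
      obtain ⟨t, rfl, ht⟩ := h1
      obtain ⟨t', rfl, ht'⟩ := h2
      exact ⟨.lie t t', rfl, lie_sub_lie_mem (hx.anchor_mem_ker h) (hgT _) ht ht'⟩
  obtain ⟨t, rfl, ht⟩ := key hv
  obtain ⟨t', htt', ht'⟩ := key hv'
  have h1 := hrel t' t (Quotient.exact htt')
  have : v - v' = (v - g t) - (v' - g t') - (g t' - g t) := by abel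
  rw [this]
  exact _root_.sub_mem (_root_.sub_mem ht ht') h1

end Related

end FreeLR

end Correspondence

/-! ### Induction on a free Lie algebra -/

/-- The elements with a property that is closed under the Lie algebra operations form a Lie
subalgebra; if it contains the generators, the inclusion has a section and it is everything. -/
theorem FreeLieAlgebra.induction {R X : Type*} [CommRing R] {P : FreeLieAlgebra R X → Prop}
    (of : ∀ x, P (FreeLieAlgebra.of R x)) (zero : P 0) (add : ∀ x y, P x → P y → P (x + y))
    (smul : ∀ (c : R) x, P x → P (c • x)) (lie : ∀ x y, P x → P y → P ⁅x, y⁆)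
    (w : FreeLieAlgebra R X) : P w := by
  let S : LieSubalgebra R (FreeLieAlgebra R X) :=
    { carrier := {x | P x}
      add_mem' := fun hx hy => add _ _ hx hy
      zero_mem' := zero
      smul_mem' := fun c _ hx => smul c _ hx
      lie_mem' := fun hx hy => lie _ _ hx hy }
  have h : S.incl.comp (FreeLieAlgebra.lift R fun x => (⟨FreeLieAlgebra.of R x, of x⟩ : S)) =
      LieHom.id := by
    ext x
    simp
  have h' := LieHom.congr_fun h w
  rw [LieHom.comp_apply, LieHom.id_apply] at h'
  rw [← h']
  exact Subtype.property _

/-! ### Local extension of functions and vector fields -/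

namespace Mfd

variable {M N : Mfd.{u}}

theorem exists_fun_eventuallyEq {g : M → ℝ} {s : Set M} {p : M} (hs : s ∈ 𝓝 p)
    (hg : ContMDiffOn (𝓡 M.dim) 𝓘(ℝ, ℝ) ∞ g s) : ∃ f : M.Fun, ∀ᶠ q in 𝓝 p, f q = g q := by
  obtain ⟨t, hts, hto, hpt⟩ := mem_nhds_iff.mp hs
  obtain ⟨χ, hχ, -⟩ := (SmoothBumpFunction.nhds_basis_support (I := 𝓡 M.dim)
    (hto.mem_nhds hpt)).mem_iff.mp (hto.mem_nhds hpt)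
  have hsm : ContMDiff (𝓡 M.dim) 𝓘(ℝ, ℝ) ∞ (fun q => χ q * g q) := by
    refine contMDiff_of_tsupport fun q hq => ?_
    have hq' : q ∈ t := hχ (tsupport_mul_subset_left hq)
    exact χ.contMDiffAt.mul ((hg.mono hts).contMDiffAt (hto.mem_nhds hq'))
  refine ⟨⟨_, hsm⟩, χ.eventuallyEq_one.mono fun q hq => ?_⟩
  change χ q * g q = g q
  rw [hq, Pi.one_apply, one_mul]

theorem exists_vectorField_eventuallyEq {X : ∀ p : M, TangentSpace (𝓡 M.dim) p} {s : Set M} {p : M}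
    (hs : s ∈ 𝓝 p) (hX : ContMDiffOn (𝓡 M.dim) (𝓡 M.dim).tangent ∞
      (fun q => (⟨q, X q⟩ : TangentBundle (𝓡 M.dim) M)) s) :
    ∃ Y : M.VF, ∀ᶠ q in 𝓝 p, Y q = X q := by
  obtain ⟨t, hts, hto, hpt⟩ := mem_nhds_iff.mp hs
  obtain ⟨χ, hχ, -⟩ := (SmoothBumpFunction.nhds_basis_support (I := 𝓡 M.dim)
    (hto.mem_nhds hpt)).mem_iff.mp (hto.mem_nhds hpt)
  refine ⟨⟨_, ContMDiffOn.smul_section_of_tsupport χ.contMDiff.contMDiffOn hto hχ (hX.mono hts)⟩,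
    χ.eventuallyEq_one.mono fun q hq => ?_⟩
  change χ q • X q = X q
  rw [hq, Pi.one_apply, one_smul]

/-- Near every point there are coordinate functions `ψ i` with dual coordinate vector fields `Z i`,
both cut off to be defined on the whole manifold. -/
theorem exists_localCoordinates (p : M) : ∃ (ψ : Fin M.dim → M.Fun) (Z : Fin M.dim → M.VF),
    ∀ᶠ q in 𝓝 p, ∀ v : TangentSpace (𝓡 M.dim) q,
      v = ∑ i, mvfderiv (𝓡 M.dim) (ψ i) q v • Z i q := by
  let b := (EuclideanSpace.basisFun (Fin M.dim) ℝ).toBasis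
  let e := trivializationAt (EuclideanSpace ℝ (Fin M.dim)) (TangentSpace (𝓡 M.dim) (M := M)) p
  have hp : (chartAt (EuclideanSpace ℝ (Fin M.dim)) p).source ∈ 𝓝 p := chart_source_mem_nhds _ p
  have hc (i : Fin M.dim) : ContMDiffOn (𝓡 M.dim) 𝓘(ℝ, ℝ) ∞
      (fun q => extChartAt (𝓡 M.dim) p q i) (chartAt (EuclideanSpace ℝ (Fin M.dim)) p).source :=
    ((EuclideanSpace.proj i : EuclideanSpace ℝ (Fin M.dim) →L[ℝ] ℝ).contMDiff).comp_contMDiffOn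
      contMDiffOn_extChartAt
  choose ψ hψ using fun i => exists_fun_eventuallyEq hp (hc i)
  have hb : e.baseSet ∈ 𝓝 p := e.open_baseSet.mem_nhds (FiberBundle.mem_baseSet_trivializationAt' p)
  choose Z hZ using fun i => exists_vectorField_eventuallyEq hb
    (e.contMDiffOn_localFrame_baseSet (I := 𝓡 M.dim) ∞ b i)
  refine ⟨ψ, Z, ?_⟩
  filter_upwards [eventually_all.mpr fun i => (hψ i).eventually_nhds, eventually_all.mpr hZ, hp, hb]
    with q hψq hZq hq hqb v
  have hd (i : Fin M.dim) : mvfderiv (𝓡 M.dim) (ψ i) q v = e.continuousLinearMapAt ℝ q v i := by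
    have h1 : mvfderiv (𝓡 M.dim) (ψ i) q =
        mvfderiv (𝓡 M.dim) ((EuclideanSpace.proj i : EuclideanSpace ℝ (Fin M.dim) →L[ℝ] ℝ) ∘
          extChartAt (𝓡 M.dim) p) q :=
      EventuallyEq.mfderiv_eq (hψq i)
    rw [h1, mvfderiv_comp_apply q
      (EuclideanSpace.proj i : EuclideanSpace ℝ (Fin M.dim) →L[ℝ] ℝ).differentiableAt.mdifferentiableAt
      (mdifferentiableAt_extChartAt hq), TangentBundle.continuousLinearMapAt_trivializationAt hq]
    simp only [mvfderiv, mfderiv_eq_fderiv, ContinuousLinearMap.fderiv]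
    rfl
  have hv : v = e.symmL ℝ q (e.continuousLinearMapAt ℝ q v) :=
    (e.symmL_continuousLinearMapAt hqb v).symm
  have hZ' (i : Fin M.dim) : Z i q = e.symmL ℝ q (b i) := by
    rw [hZq, e.localFrame_apply_of_mem_baseSet b hqb, Bundle.Trivialization.basisAt,
      Module.Basis.map_apply, e.symmL_apply hqb]
    exact e.linearEquivAt_symm_apply q hqb (b i)
  simp only [hd, hZ', ← map_smul, ← map_sum]
  conv_lhs => rw [hv, ← b.sum_repr (e.continuousLinearMapAt ℝ q v)]
  rfl

/-- Through an immersion every smooth function on the source extends locally to the target. In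
suitable charts the immersion is the inclusion of a slice, and the extension is constant along the
complementary directions. -/
theorem exists_fun_extension {F : M → N} {p : M}
    (hF : IsImmersionAt (𝓡 M.dim) (𝓡 N.dim) ∞ F p) (f : M.Fun) :
    ∃ g : N.Fun, ∀ᶠ q in 𝓝 p, g (F q) = f q := by
  obtain ⟨E, _, _, hF⟩ := hF
  let π : N → EuclideanSpace ℝ (Fin M.dim) := fun y => (hF.equiv.symm (hF.codChart y)).1
  have hπ : ContMDiffOn (𝓡 N.dim) (𝓡 M.dim) ∞ π hF.codChart.source := by
    have h1 : ContMDiffOn (𝓡 N.dim) (𝓡 N.dim) ∞ hF.codChart hF.codChart.source :=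
      contMDiffOn_of_mem_maximalAtlas hF.codChart_mem_maximalAtlas
    have h2 : ContDiff ℝ ∞ (fun z => (hF.equiv.symm z).1) := by fun_prop
    exact h2.contMDiff.comp_contMDiffOn h1
  have key : ∀ q ∈ hF.domChart.source, π (F q) = hF.domChart q := by
    intro q hq
    have := hF.writtenInCharts (show hF.domChart q ∈ (hF.domChart.extend (𝓡 M.dim)).target by
      simpa using hF.domChart.map_source hq)
    have h' : hF.codChart (F q) = hF.equiv (hF.domChart q, 0) := by
      simpa [hF.domChart.left_inv hq] using this
    simp [π, h']
  have hs : hF.codChart.source ∩ π ⁻¹' hF.domChart.target ∈ 𝓝 (F p) := by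
    refine (hπ.continuousOn.isOpen_inter_preimage hF.codChart.open_source
      hF.domChart.open_target).mem_nhds ⟨hF.mem_codChart_source, ?_⟩
    rw [mem_preimage, key p hF.mem_domChart_source]
    exact hF.domChart.map_source hF.mem_domChart_source
  have hsm : ContMDiffOn (𝓡 N.dim) 𝓘(ℝ, ℝ) ∞ (fun y => f (hF.domChart.symm (π y)))
      (hF.codChart.source ∩ π ⁻¹' hF.domChart.target) :=
    f.contMDiff.comp_contMDiffOn
      ((contMDiffOn_symm_of_mem_maximalAtlas hF.domChart_mem_maximalAtlas).comp
        (hπ.mono inter_subset_left) inter_subset_right)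
  obtain ⟨g, hg⟩ := exists_fun_eventuallyEq hs hsm
  refine ⟨g, ?_⟩
  filter_upwards [hF.continuousAt.eventually hg,
    hF.domChart.open_source.mem_nhds hF.mem_domChart_source] with q hq hqs
  rw [hq, key q hqs, hF.domChart.left_inv hqs]

theorem sum_apply {ι : Type*} (s : Finset ι) (X : ι → M.VF) (p : M) :
    (∑ i ∈ s, X i) p = ∑ i ∈ s, X i p := by
  classical
  induction s using Finset.induction_on with
  | empty => rfl
  | insert i s hi h => rw [Finset.sum_insert hi, Finset.sum_insert hi, ← h]; rfl

/-- Restriction of functions on `N` to germs at `p` along a map `F : M → N`. -/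
noncomputable def germAlong (F : M → N) (p : M) : N.Fun →+* Germ (𝓝 p) ℝ where
  toFun f := ((fun q => f (F q) : M → ℝ) : Germ (𝓝 p) ℝ)
  map_one' := rfl
  map_mul' _ _ := rfl
  map_zero' := rfl
  map_add' _ _ := rfl

theorem germAlong_eq_iff {F : M → N} {p : M} {f : M.Fun} {g : N.Fun} :
    germAlong (fun q => q) p f = germAlong F p g ↔ ∀ᶠ q in 𝓝 p, f q = g (F q) :=
  Germ.coe_eq

theorem mem_ker_germAlong {F : M → N} {p : M} {g : N.Fun} :
    g ∈ RingHom.ker (germAlong F p) ↔ ∀ᶠ q in 𝓝 p, g (F q) = 0 :=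
  Germ.coe_eq

/-- Vector fields `X` on `M` and `Y` on `N` are `F`-related near `p`. -/
def RelatedNear (F : M → N) (p : M) (X : M.VF) (Y : N.VF) : Prop :=
  ∀ᶠ q in 𝓝 p, mfderiv (𝓡 M.dim) (𝓡 N.dim) F q (X q) = Y (F q)

/-- A vector field `Y` is a combination of vector fields with coefficients that vanish, near a given
point, wherever `Y` does. Hence it lies in `I • ⊤` as soon as `I` contains all such functions. -/
theorem mem_ideal_smul_top {I : Ideal M.Fun} {p : M} {Y : M.VF}
    (hI : ∀ c : M.Fun, (∀ᶠ q in 𝓝 p, Y q = 0 → c q = 0) → c ∈ I) :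
    Y ∈ (I • ⊤ : Submodule M.Fun M.VF) := by
  obtain ⟨ψ, Z, hψ⟩ := exists_localCoordinates p
  let Y' : M.VF := Y - ∑ i, Y.deriv (ψ i) • Z i
  have hY' : ∀ᶠ q in 𝓝 p, Y' q = 0 := by
    filter_upwards [hψ] with q hq
    change Y q - (∑ i, Y.deriv (ψ i) • Z i) q = 0
    rw [sum_apply, sub_eq_zero]
    exact hq (Y q)
  -- `Y'` is supported away from `p`, hence equal to `(1 - χ) • Y'` for a bump function `χ` at `p`
  obtain ⟨χ, hχ, -⟩ := (SmoothBumpFunction.nhds_basis_support (I := 𝓡 M.dim) hY').mem_iff.mp hY'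
  let c : M.Fun := ⟨fun q => 1 - χ q, contMDiff_const.sub χ.contMDiff⟩
  have hc : c • Y' = Y' := by
    ext1 q
    change (1 - χ q) • Y' q = Y' q
    by_cases hq : χ q = 0
    · rw [hq, sub_zero, one_smul]
    · rw [show Y' q = 0 from hχ (subset_tsupport _ hq), smul_zero]
  have hYY : Y = c • Y' + ∑ i, Y.deriv (ψ i) • Z i := by
    rw [hc, sub_add_cancel]
  rw [hYY]
  refine add_mem (Submodule.smul_mem_smul (hI c ?_) trivial)
    (sum_mem fun i _ => Submodule.smul_mem_smul (hI _ ?_) trivial)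
  · filter_upwards [χ.eventuallyEq_one] with q hq _
    change 1 - χ q = 0
    rw [hq, Pi.one_apply, sub_self]
  · refine Eventually.of_forall fun q hq => ?_
    change mvfderiv (𝓡 M.dim) (ψ i) q (Y q) = 0
    rw [hq, map_zero]

/-- The pull-back `g ∘ F` of a smooth function `g`. -/
noncomputable def pullback (F : LocalEmbedding M N) (g : N.Fun) : M.Fun :=
  ⟨fun q => g (F q), g.contMDiff.comp F.smooth⟩

theorem mvfderiv_pullback (F : LocalEmbedding M N) (g : N.Fun) (p : M)
    (v : TangentSpace (𝓡 M.dim) p) :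
    mvfderiv (𝓡 M.dim) (pullback F g) p v =
      mvfderiv (𝓡 N.dim) g (F p) (mfderiv (𝓡 M.dim) (𝓡 N.dim) F p v) :=
  mvfderiv_comp_apply p g.mdifferentiableAt (F.smooth.mdifferentiableAt (by simp)) v

theorem isImmersionAt (F : LocalEmbedding M N) (p : M) :
    IsImmersionAt (𝓡 M.dim) (𝓡 N.dim) ∞ F p := by
  obtain ⟨U, -, hp, hU, -⟩ := F.locally_embedding p
  exact hU p hp

theorem exists_relatedNear (F : LocalEmbedding M N) (p : M) (X : M.VF) :
    ∃ Y : N.VF, RelatedNear F p X Y := by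
  obtain ⟨ψ, Z, hψ⟩ := exists_localCoordinates (F p)
  -- the components of `dF ∘ X` in the coordinates `ψ` are the functions `X (ψ i ∘ F)`
  choose g hg using fun i =>
    exists_fun_extension (isImmersionAt F p) (X.deriv (pullback F (ψ i)))
  refine ⟨∑ i, g i • Z i, ?_⟩
  filter_upwards [F.smooth.continuous.continuousAt.eventually hψ, eventually_all.mpr hg]
    with q hq hgq
  rw [sum_apply, hq (mfderiv (𝓡 M.dim) (𝓡 N.dim) F q (X q))]
  refine Finset.sum_congr rfl fun i _ => ?_
  rw [smul_VF_apply, hgq]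
  exact congrArg (· • Z i (F q)) (mvfderiv_pullback F (ψ i) q (X q)).symm

/-- Near a point of `M`, a local embedding puts the vector fields on `M` and on `N` into
correspondence. -/
theorem isCorrespondence (F : LocalEmbedding M N) (p : M) :
    IsCorrespondence M.anchor N.anchor (germAlong (fun q => q) p) (germAlong F p)
      (RelatedNear F p) where
  add {X X' Y Y'} h h' := by
    filter_upwards [h, h'] with q hq hq'
    change mfderiv (𝓡 M.dim) (𝓡 N.dim) F q (X q + X' q) = Y (F q) + Y' (F q)
    rw [map_add, hq, hq']
  smul {a b X Y} hab h := by
    filter_upwards [h, germAlong_eq_iff.mp hab] with q hq hab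
    rw [smul_VF_apply, smul_VF_apply, map_smul, hq, hab]
  anchor {X Y a b} h hab := by
    rw [germAlong_eq_iff] at hab ⊢
    filter_upwards [h, hab.eventually_nhds] with q hq hab
    have hab' : (a : M → ℝ) =ᶠ[𝓝 q] pullback F b := hab
    rw [anchor_apply, anchor_apply, ← hq, ← mvfderiv_pullback]
    exact congrArg (fun L => L (X q)) (hab'.mfderiv_eq (I := 𝓡 M.dim) (I' := 𝓘(ℝ, ℝ)))
  exists_coeff f := by
    obtain ⟨g, hg⟩ := exists_fun_extension (isImmersionAt F p) f
    exact ⟨g, germAlong_eq_iff.mpr (hg.mono fun _ h => h.symm)⟩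
  exists_related := exists_relatedNear F p
  sub_mem {X Y Y'} h h' := by
    refine mem_ideal_smul_top (p := F p) fun c hc => mem_ker_germAlong.mpr ?_
    filter_upwards [h, h', F.smooth.continuous.continuousAt.eventually hc] with q hq hq' hc
    refine hc ?_
    change Y (F q) - Y' (F q) = 0
    rw [← hq, ← hq', sub_self]

end Mfd

/-! ### Related infinitesimal paths and the induced maps on fibres -/

namespace Mfd

variable {M N P : Mfd.{u}}

/-- Infinitesimal paths on `M` and on `N` are `F`-related near `p`: they are obtained in parallel
from vector fields and functions that are `F`-related near `p`. -/
abbrev PathRelated (F : M → N) (p : M) : M.R → N.R → Prop :=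
  FreeLR.Related M.anchor N.anchor (germAlong (fun q => q) p) (germAlong F p) (RelatedNear F p)

theorem PathRelated.const_smul {F : M → N} {p : M} {u : M.R} {v : N.R} (h : PathRelated F p u v)
    (c : ℝ) : PathRelated F p (c • u) (c • v) :=
  FreeLR.Related.smul (a := algebraMap ℝ M.Fun c) (b := algebraMap ℝ N.Fun c) rfl h

theorem PathRelated.lift {F : M → N} {p : M} {ι : Type} {X : ι → M.VF} {Y : ι → N.VF}
    (h : ∀ i, RelatedNear F p (X i) (Y i)) (w : FreeLieAlgebra ℝ ι) :
    PathRelated F p (FreeLieAlgebra.lift ℝ (fun i => FreeLR.of M.anchor (X i)) w)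
      (FreeLieAlgebra.lift ℝ (fun i => FreeLR.of N.anchor (Y i)) w) := by
  induction w using FreeLieAlgebra.induction with
  | of i => simpa only [FreeLieAlgebra.lift_of_apply] using FreeLR.Related.of (h i)
  | zero => simpa only [map_zero] using FreeLR.Related.zero
  | add x y hx hy => simpa only [map_add] using hx.add hy
  | smul c x hx => simpa only [map_smul] using hx.const_smul c
  | lie x y hx hy => simpa only [LieHom.map_lie] using hx.lie hy

theorem value_eq_zero {p : M} {u : M.R} (h : u ∈ (maxIdeal p • ⊤ : Submodule M.Fun M.R)) :
    value p u = 0 :=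
  (Submodule.Quotient.mk_eq_zero _).mpr h

theorem exists_value_eq {p : M} (z : RTFibre p) : ∃ u, value p u = z := by
  obtain ⟨u, hu⟩ := Submodule.Quotient.mk_surjective _ z
  exact ⟨u, hu⟩

theorem value_smul (p : M) (f : M.Fun) (u : M.R) : value p (f • u) = f p • value p u := by
  have h : value p (f • u - f p • u) = 0 := by
    change value p (f • u - algebraMap ℝ M.Fun (f p) • u) = 0
    rw [← sub_smul]
    exact value_eq_zero (Submodule.smul_mem_smul (sub_self (f p)) trivial)
  rw [map_sub, sub_eq_zero] at h
  exact h.trans ((value p).map_smul (f p) u)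

theorem value_of_eq {p : M} {X Y : M.VF} (h : X p = Y p) :
    value p (FreeLR.of M.anchor X) = value p (FreeLR.of M.anchor Y) := by
  rw [← sub_eq_zero, ← map_sub, ← map_sub]
  refine value_eq_zero (FreeLR.of_mem_smul_top (mem_ideal_smul_top (p := p) fun c hc => ?_))
  exact hc.self_of_nhds (sub_eq_zero.mpr h)

theorem PathRelated.value_eq {F : LocalEmbedding M N} {p : M} {u : M.R} {v v' : N.R}
    (h : PathRelated F p u v) (h' : PathRelated F p u v') : value (F p) v = value (F p) v' := by
  rw [← sub_eq_zero, ← map_sub]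
  refine value_eq_zero (Submodule.smul_mono_left (fun g hg => ?_)
    (FreeLR.Related.sub_mem (isCorrespondence F p) h h'))
  exact (mem_ker_germAlong.mp hg).self_of_nhds

theorem exists_pathRelated (F : LocalEmbedding M N) (p : M) (u : M.R) :
    ∃ v, PathRelated F p u v :=
  FreeLR.Related.exists_related (isCorrespondence F p) u

/-- The value at `F p` of any infinitesimal path on `N` that is `F`-related near `p` to a given one
on `M`. -/
noncomputable def relatedValue (F : LocalEmbedding M N) (p : M) : M.R →ₗ[ℝ] RTFibre (F p) where
  toFun u := value (F p) (exists_pathRelated F p u).choose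
  map_add' u v := by
    rw [← map_add]
    exact (exists_pathRelated F p _).choose_spec.value_eq
      ((exists_pathRelated F p u).choose_spec.add (exists_pathRelated F p v).choose_spec)
  map_smul' c u := by
    refine Eq.trans ?_ ((value (F p)).map_smul c (exists_pathRelated F p u).choose)
    exact (exists_pathRelated F p _).choose_spec.value_eq
      ((exists_pathRelated F p u).choose_spec.const_smul c)

theorem relatedValue_eq {F : LocalEmbedding M N} {p : M} {u : M.R} {v : N.R}
    (h : PathRelated F p u v) : relatedValue F p u = value (F p) v :=
  (exists_pathRelated F p u).choose_spec.value_eq h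

theorem relatedValue_eq_zero (F : LocalEmbedding M N) (p : M) {u : M.R}
    (hu : u ∈ (maxIdeal p • ⊤ : Submodule M.Fun M.R)) : relatedValue F p u = 0 := by
  refine Submodule.smul_induction_on (p := fun u => relatedValue F p u = 0) hu (fun a ha u _ => ?_)
    fun u v hu hv => by rw [map_add, hu, hv, add_zero]
  obtain ⟨b, hb⟩ := (isCorrespondence F p).exists_coeff a
  obtain ⟨v, hv⟩ := exists_pathRelated F p u
  have hbp : a p = b (F p) := (germAlong_eq_iff.mp hb).self_of_nhds
  rw [relatedValue_eq (hv.smul hb), value_smul, ← hbp, show a p = 0 from ha, zero_smul]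

/-- The map of fibres induced by a local embedding: the value at `p` of an infinitesimal path goes
to the value at `F p` of any infinitesimal path that is `F`-related to it near `p`. -/
noncomputable def fibreMap (F : LocalEmbedding M N) (p : M) : RTFibre p →ₗ[ℝ] RTFibre (F p) :=
  (((maxIdeal p • ⊤ : Submodule M.Fun M.R).restrictScalars ℝ).liftQ (relatedValue F p)
    fun _ hu => relatedValue_eq_zero F p hu).comp
    (Submodule.Quotient.restrictScalarsEquiv ℝ
      (maxIdeal p • ⊤ : Submodule M.Fun M.R)).symm.toLinearMap

theorem fibreMap_value {F : LocalEmbedding M N} {p : M} {u : M.R} {v : N.R}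
    (h : PathRelated F p u v) : fibreMap F p (value p u) = value (F p) v :=
  relatedValue_eq h

/-- The counterpart of an iterated bracket of vector fields can be chosen as an iterated bracket of
the same length, and simultaneously for all points near `p`. -/
theorem exists_isMonomial_pathRelated (F : LocalEmbedding M N) (p : M) {d : ℕ} {u : M.R}
    (h : FreeLR.IsMonomial M.anchor d u) :
    ∃ v, FreeLR.IsMonomial N.anchor d v ∧ ∀ᶠ q in 𝓝 p, PathRelated F q u v := by
  induction h with
  | of X =>
    obtain ⟨Y, hY⟩ := exists_relatedNear F p X
    exact ⟨_, .of Y, (Filter.Eventually.eventually_nhds hY).mono fun q hq => .of hq⟩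
  | lie _ _ h1 h2 =>
    obtain ⟨v, hv, h1⟩ := h1
    obtain ⟨w, hw, h2⟩ := h2
    exact ⟨_, .lie hv hw, (h1.and h2).mono fun q hq => hq.1.lie hq.2⟩

theorem isSmoothAlong_fibreMap (F : LocalEmbedding M N) (d : ℕ) {u : M.R} (hu : u ∈ M.Rle d) :
    IsSmoothAlong F d fun p => fibreMap F p (value p u) := by
  intro p
  induction hu using Submodule.span_induction with
  | mem u hu =>
    obtain ⟨i, hi, hu⟩ := hu
    obtain ⟨v, hv, h⟩ := exists_isMonomial_pathRelated F p hu
    refine ⟨1, fun _ => 1, fun _ => v, fun _ => Submodule.subset_span ⟨i, hi, hv⟩, ?_⟩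
    filter_upwards [h] with q hq
    rw [fibreMap_value hq, Fin.sum_univ_one]
    exact (one_smul ℝ _).symm
  | zero => exact ⟨0, Fin.elim0, Fin.elim0, fun i => i.elim0, by simp⟩
  | add u u' _ _ h h' =>
    obtain ⟨n, f, v, hv, h⟩ := h
    obtain ⟨n', f', v', hv', h'⟩ := h'
    refine ⟨n + n', Fin.append f f', Fin.append v v', fun i => ?_, ?_⟩
    · induction i using Fin.addCases with
      | left i => rw [Fin.append_left]; exact hv i
      | right i => rw [Fin.append_right]; exact hv' i
    · filter_upwards [h, h'] with q hq hq'
      rw [map_add, map_add, hq, hq', Fin.sum_univ_add]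
      simp only [Fin.append_left, Fin.append_right]
  | smul a u _ h =>
    obtain ⟨n, f, v, hv, h⟩ := h
    refine ⟨n, fun i => a * f i, v, hv, ?_⟩
    filter_upwards [h] with q hq
    rw [value_smul, map_smul, hq, Finset.smul_sum]
    exact Finset.sum_congr rfl fun i _ => (mul_smul _ _ _).symm

/-- The bundle map induced by a local embedding. -/
noncomputable def rtMap (F : LocalEmbedding M N) : RTMap F where
  fibre := fibreMap F
  smooth d _ hu := isSmoothAlong_fibreMap F d hu

theorem rtMap_extends (F : LocalEmbedding M N) : (rtMap F).Extends where
  differential p X Y h := by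
    obtain ⟨Y', hY'⟩ := exists_relatedNear F p X
    exact (fibreMap_value (.of hY')).trans (value_of_eq (hY'.self_of_nhds.symm.trans h))
  bracket p _ _ _ h w := fibreMap_value (PathRelated.lift h w)

theorem pathRelated_id (p : M) (u : M.R) : PathRelated (LocalEmbedding.id M) p u u := by
  induction u using Quotient.ind with | _ t
  change PathRelated (LocalEmbedding.id M) p (FreeLR.mk _ t) (FreeLR.mk _ t)
  induction t with
  | of X =>
    refine FreeLR.Related.of (Eventually.of_forall fun q => ?_)
    exact congrArg (fun L => L (X q)) mfderiv_id
  | zero => exact .zero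
  | add x y hx hy => exact hx.add hy
  | smul a x hx => exact hx.smul rfl
  | lie x y hx hy => exact hx.lie hy

/-- Every infinitesimal path on `M` can be transported along `F` and then along `G` in such a way
that the result is also related to it along `G ∘ F`. -/
theorem exists_pathRelated_comp (F : LocalEmbedding M N) (G : LocalEmbedding N P) (p : M)
    (u : M.R) : ∃ v w, PathRelated F p u v ∧ PathRelated G (F p) v w ∧
      PathRelated (G.comp F) p u w := by
  have hF : Tendsto F (𝓝 p) (𝓝 (F p)) := F.smooth.continuous.continuousAt
  induction u using Quotient.ind with | _ t
  change ∃ v w, PathRelated F p (FreeLR.mk _ t) v ∧ PathRelated G (F p) v w ∧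
      PathRelated (G.comp F) p (FreeLR.mk _ t) w
  induction t with
  | of X =>
    obtain ⟨Y, hY⟩ := exists_relatedNear F p X
    obtain ⟨Z, hZ⟩ := exists_relatedNear G (F p) Y
    refine ⟨_, _, .of hY, .of hZ, FreeLR.Related.of ?_⟩
    filter_upwards [hY, hF.eventually hZ] with q hq hq'
    refine (mfderiv_comp_apply (I' := 𝓡 N.dim) q (G.smooth.mdifferentiableAt (by simp))
      (F.smooth.mdifferentiableAt (by simp)) (X q)).trans ?_
    rw [hq, hq']
    rfl
  | zero => exact ⟨0, 0, .zero, .zero, .zero⟩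
  | add x y hx hy =>
    obtain ⟨v, w, h1, h2, h3⟩ := hx
    obtain ⟨v', w', h1', h2', h3'⟩ := hy
    exact ⟨_, _, h1.add h1', h2.add h2', h3.add h3'⟩
  | smul a x hx =>
    obtain ⟨v, w, h1, h2, h3⟩ := hx
    obtain ⟨b, hb⟩ := (isCorrespondence F p).exists_coeff a
    obtain ⟨c, hc⟩ := (isCorrespondence G (F p)).exists_coeff b
    refine ⟨_, _, h1.smul hb, h2.smul hc, h3.smul (germAlong_eq_iff.mpr ?_)⟩
    filter_upwards [germAlong_eq_iff.mp hb, hF.eventually (germAlong_eq_iff.mp hc)] with q hq hq'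
    exact hq.trans hq'
  | lie x y hx hy =>
    obtain ⟨v, w, h1, h2, h3⟩ := hx
    obtain ⟨v', w', h1', h2', h3'⟩ := hy
    exact ⟨_, _, h1.lie h1', h2.lie h2', h3.lie h3'⟩

end Mfd

theorem mainTheorem2 :
    ∃ RF : ∀ (M N : Mfd.{u}) (F : LocalEmbedding M N), RTMap F,
      (∀ (M N : Mfd.{u}) (F : LocalEmbedding M N), (RF M N F).Extends) ∧
      (∀ M : Mfd.{u}, (RF M M (LocalEmbedding.id M)).total = id) ∧
      (∀ (M N P : Mfd.{u}) (F : LocalEmbedding M N) (G : LocalEmbedding N P),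
        (RF M P (G.comp F)).total = (RF N P G).total ∘ (RF M N F).total) := by
  refine ⟨fun M N F => Mfd.rtMap F, fun M N F => Mfd.rtMap_extends F, fun M => ?_,
    fun M N P F G => ?_⟩
  · funext ⟨p, z⟩
    obtain ⟨u, rfl⟩ := Mfd.exists_value_eq z
    exact congrArg (Sigma.mk p) (Mfd.fibreMap_value (Mfd.pathRelated_id p u))
  · funext ⟨p, z⟩
    obtain ⟨u, rfl⟩ := Mfd.exists_value_eq z
    obtain ⟨v, w, h1, h2, h3⟩ := Mfd.exists_pathRelated_comp F G p u
    refine congrArg (Sigma.mk (G (F p))) ((Mfd.fibreMap_value h3).trans ?_)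
    change _ = Mfd.fibreMap G (F p) (Mfd.fibreMap F p (Mfd.value p u))
    rw [Mfd.fibreMap_value h1]
    exact (Mfd.fibreMap_value h2).symm
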